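/- Let $k:\mathbb{Z}\to\mathbb{R}$ be a positive definite symmetric function, i.e. $k(-t)=k(t)$ for all $t$ and $\sum_{s,t\in S}x_s\,k(t-s)\,x_t\ge 0$ for every finite $S\subset\mathbb{Z}$ and all real $(x_s)_{s\in S}$. Assume that $$\sum_{t\in\mathbb{Z}}|k(t)|=M<+\infty ,$$ and denote by $f(\lambda)=\sum_{t\in\mathbb{Z}}\mathrm{e}^{\mathrm{i}\lambda t}k(t)$ the corresponding (real-valued) spectral density. Let $Z=(Z_t)_{t\in\mathbb{Z}}$ be a centered stationary Gaussian process with covariance function $k$, i.e. $\mathbb{E}[Z_t]=0$ and $\mathbb{E}[Z_sZ_t]=k(t-s)$ for all $s,t\in\mathbb{Z}$, and let $m_\infty$ be a real number. Then for all $\alpha$ such that $0\le\alpha<1/(2M)$ (for all $\alpha\ge 0$ if $M=0$), $$\lim_{t\to+\infty}\frac1t\log\left(\mathbb{E}\left[\exp\left(-\alpha\sum_{s=0}^{t-1}(Z_s+m_\infty)^2\right)\right]\right)=-\ell_0(\alpha)-\ell_1(\alpha),$$ where $$\ell_0(\alpha)=\frac{1}{4\pi}\int_0^{2\pi}\log(1+2\alpha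 f(\lambda))\,\mathrm{d}\lambda \qquad\text{and}\qquad \ell_1(\alpha)=m_\infty^2\,\alpha\,(1+2\alpha f(0))^{-1}.$$ -/

import Mathlib

open MeasureTheory ProbabilityTheory Filter Topology

/-- A positive definite symmetric function on the integers, in the sense used for covariance
functions: `k (-t) = k t` and `∑ s, ∑ t, x s * k (t - s) * x t ≥ 0` for all finite families of
real coefficients. -/
def IsPositiveDefiniteSymmetric (k : ℤ → ℝ) : Prop :=
  (∀ t : ℤ, k (-t) = k t) ∧
    ∀ (S : Finset ℤ) (x : ℤ → ℝ), 0 ≤ ∑ s ∈ S, ∑ t ∈ S, x s * k (t - s) * x t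

/-- The spectral density `f(u) = ∑_{t ∈ ℤ} exp(i u t) k(t)`. -/
noncomputable def spectralDensity (k : ℤ → ℝ) (u : ℝ) : ℂ :=
  ∑' t : ℤ, Complex.exp (Complex.I * u * t) * (k t : ℂ)

/-- The spectral density of a symmetric function is real, so that taking its real part below
loses nothing. -/
theorem spectralDensity_eq_re {k : ℤ → ℝ} (hk : ∀ t : ℤ, k (-t) = k t) (u : ℝ) :
    spectralDensity k u = ((spectralDensity k u).re : ℂ) := by
  refine (Complex.conj_eq_iff_re.mp ?_).symm
  unfold spectralDensity
  rw [Complex.conj_tsum, ← (Equiv.neg ℤ).tsum_eq]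
  refine tsum_congr fun t => ?_
  simp [← Complex.exp_conj, hk]

/-- `ℓ₀(α) = (1 / 4π) ∫₀^{2π} log (1 + 2 α f(u)) du`. -/
noncomputable def ell0 (k : ℤ → ℝ) (α : ℝ) : ℝ :=
  1 / (4 * Real.pi) *
    ∫ u in (0 : ℝ)..(2 * Real.pi), Real.log (1 + 2 * α * (spectralDensity k u).re)

/-- `ℓ₁(α) = m∞² α (1 + 2 α f(0))⁻¹`. -/
noncomputable def ell1 (k : ℤ → ℝ) (mInf : ℝ) (α : ℝ) : ℝ :=
  mInf ^ 2 * α * (1 + 2 * α * (spectralDensity k 0).re)⁻¹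

/-! Diagonalising the Toeplitz covariance matrix turns the Gaussian expectation into a product over
eigenvalues, so the logarithm splits into a trace of `log (1 + 2 α x)` and the quadratic form of
`(1 + 2 α x)⁻¹` at a constant vector. By summability of `k`, a truncated wave of frequency `u` is
an approximate eigenvector with approximate eigenvalue `f(u)`: only rows near the boundary
contribute to the error, which is therefore negligible on average. A Korovkin-type inequality
`|g(x) - g(y)| ≤ ε + C (x - y) ^ 2` then shows that the spectral measure of the matrix at such a
wave concentrates at `f(u)`. The frequency `u = 0` gives `ℓ₁`. Averaging over `u` recovers the
trace, because the mean of the periodogram of a unit vector is one; this gives `ℓ₀`, which is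
Szegő's limit theorem. -/

section Gaussian

theorem integral_exp_neg_mul_add_sq_gaussianReal (v : NNReal) {α : ℝ} (hα : 0 < 1 + 2 * α * v)
    (c : ℝ) :
    ∫ x, Real.exp (-α * (x + c) ^ 2) ∂gaussianReal 0 v =
      (√(1 + 2 * α * v))⁻¹ * Real.exp (-α * c ^ 2 / (1 + 2 * α * v)) := by
  rcases eq_or_ne v 0 with rfl | hv
  · simp
  obtain ⟨b, hb⟩ : ∃ b : ℝ, 1 + 2 * α * v = 2 * v * b := ⟨(1 + 2 * α * v) / (2 * v), by field_simp⟩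
  have hb0 : 0 < b := pos_of_mul_pos_right (hb ▸ hα) (by positivity)
  have hα_eq : α = b - 1 / (2 * v) := by
    field_simp
    linear_combination hb
  have complete_square : ∀ x : ℝ, gaussianPDFReal 0 v x • Real.exp (-α * (x + c) ^ 2) =
      ((√(2 * Real.pi * v))⁻¹ * Real.exp (-α * c ^ 2 / (2 * v * b))) *
        Real.exp (-b * (x + α * c / b) ^ 2) := fun x => by
    rw [gaussianPDFReal, smul_eq_mul, mul_assoc (√(2 * Real.pi * v))⁻¹,
      mul_assoc (√(2 * Real.pi * v))⁻¹, ← Real.exp_add, ← Real.exp_add, hα_eq]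
    congr 2
    field_simp
    ring
  have normalization : (√(2 * Real.pi * v))⁻¹ * √(Real.pi / b) = (√(2 * v * b))⁻¹ := by
    rw [← Real.sqrt_inv, ← Real.sqrt_inv, ← Real.sqrt_mul (by positivity)]
    congr 1
    field_simp
  rw [hb]
  calc ∫ x, Real.exp (-α * (x + c) ^ 2) ∂gaussianReal 0 v
      = ((√(2 * Real.pi * v))⁻¹ * Real.exp (-α * c ^ 2 / (2 * v * b))) *
          ∫ x, Real.exp (-b * (x + α * c / b) ^ 2) := by
        rw [integral_gaussianReal_eq_integral_smul hv, ← integral_const_mul]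
        exact integral_congr_ae (ae_of_all _ complete_square)
    _ = (√(2 * v * b))⁻¹ * Real.exp (-α * c ^ 2 / (2 * v * b)) := by
        rw [integral_add_right_eq_self (fun x : ℝ => Real.exp (-b * x ^ 2)), integral_gaussian,
          mul_right_comm, normalization]

variable {Ω ι : Type*} [MeasurableSpace Ω] {P : Measure Ω} [Fintype ι]

theorem log_integral_exp_neg_mul_sum_add_sq_of_iIndepFun {Y : ι → Ω → ℝ} {v : ι → NNReal}
    (hindep : iIndepFun Y P) (hlaw : ∀ i, HasLaw (Y i) (gaussianReal 0 (v i)) P) {α : ℝ}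
    (hα : ∀ i, 0 < 1 + 2 * α * v i) (c : ι → ℝ) :
    Real.log (∫ ω, Real.exp (-α * ∑ i, (Y i ω + c i) ^ 2) ∂P) =
      ∑ i, (-(1 / 2) * Real.log (1 + 2 * α * v i) - α * (c i ^ 2 * (1 + 2 * α * v i)⁻¹)) := by
  have hmeas : ∀ i, Measurable fun x : ℝ => Real.exp (-α * (x + c i) ^ 2) := fun i => by fun_prop
  have factor : ∫ ω, Real.exp (-α * ∑ i, (Y i ω + c i) ^ 2) ∂P =
      ∏ i, (√(1 + 2 * α * v i))⁻¹ * Real.exp (-α * c i ^ 2 / (1 + 2 * α * v i)) := by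
    simp_rw [Finset.mul_sum, Real.exp_sum]
    rw [hindep.integral_fun_prod_comp (fun i => (hlaw i).aemeasurable)
      fun i => (hmeas i).aestronglyMeasurable]
    refine Finset.prod_congr rfl fun i _ => ?_
    rw [← integral_exp_neg_mul_add_sq_gaussianReal _ (hα i), ← (hlaw i).map_eq,
      integral_map (hlaw i).aemeasurable (hmeas i).aestronglyMeasurable]
  have hsqrt : ∀ i, (√(1 + 2 * α * v i))⁻¹ ≠ 0 := fun i =>
    inv_ne_zero (Real.sqrt_ne_zero'.2 (hα i))
  rw [factor, Real.log_prod fun i _ => mul_ne_zero (hsqrt i) (Real.exp_ne_zero _)]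
  refine Finset.sum_congr rfl fun i _ => ?_
  rw [Real.log_mul (hsqrt i) (Real.exp_ne_zero _), Real.log_exp, Real.log_inv,
    Real.log_sqrt (hα i).le]
  ring

theorem log_integral_exp_neg_mul_norm_add_sq {E : Type*} [NormedAddCommGroup E]
    [InnerProductSpace ℝ E] [MeasurableSpace E] [BorelSpace E] (b : OrthonormalBasis ι ℝ E)
    {X : Ω → E} (hX : HasGaussianLaw X P) {v : ι → NNReal}
    (hmean : ∀ i, ∫ ω, inner ℝ (b i) (X ω) ∂P = 0)
    (hvar : ∀ i, ∫ ω, inner ℝ (b i) (X ω) * inner ℝ (b i) (X ω) ∂P = v i)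
    (huncorr : ∀ i j, i ≠ j → ∫ ω, inner ℝ (b i) (X ω) * inner ℝ (b j) (X ω) ∂P = 0)
    {α : ℝ} (hα : ∀ i, 0 < 1 + 2 * α * v i) (c : E) :
    Real.log (∫ ω, Real.exp (-α * ‖X ω + c‖ ^ 2) ∂P) =
      ∑ i, (-(1 / 2) * Real.log (1 + 2 * α * v i) -
        α * (inner ℝ (b i) c ^ 2 * (1 + 2 * α * v i)⁻¹)) := by
  have := hX.isProbabilityMeasure
  have hcoord : HasGaussianLaw (fun ω i => inner ℝ (b i) (X ω)) P :=
    hX.map_fun (ContinuousLinearMap.pi fun i => innerSL ℝ (b i))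
  have hcov : ∀ i j, cov[fun ω => inner ℝ (b i) (X ω), fun ω => inner ℝ (b j) (X ω); P] =
      ∫ ω, inner ℝ (b i) (X ω) * inner ℝ (b j) (X ω) ∂P := fun i j => by
    simp [covariance, hmean]
  have hindep : iIndepFun (fun i ω => inner ℝ (b i) (X ω)) P :=
    hcoord.iIndepFun_of_covariance_eq_zero fun i j hij => by rw [hcov, huncorr i j hij]
  have hlaw : ∀ i, HasLaw (fun ω => inner ℝ (b i) (X ω)) (gaussianReal 0 (v i)) P := fun i => by
    have hi := hcoord.eval i
    refine ⟨hi.aemeasurable, ?_⟩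
    rw [hi.map_eq_gaussianReal, ← covariance_self hi.aemeasurable, hcov, hvar, hmean,
      Real.toNNReal_coe]
  have parseval : ∀ ω, ‖X ω + c‖ ^ 2 = ∑ i, (inner ℝ (b i) (X ω) + inner ℝ (b i) c) ^ 2 :=
    fun ω => by simp [← b.sum_sq_norm_inner_right, inner_add_right]
  simp_rw [parseval]
  exact log_integral_exp_neg_mul_sum_add_sq_of_iIndepFun hindep hlaw hα _

theorem integral_inner_mul_inner_eq_inner_toEuclideanLin [DecidableEq ι]
    {X : Ω → EuclideanSpace ℝ ι} (hX : ∀ s, MemLp (fun ω => X ω s) 2 P) {A : Matrix ι ι ℝ}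
    (hA : ∀ s t, ∫ ω, X ω s * X ω t ∂P = A s t) (x y : EuclideanSpace ℝ ι) :
    ∫ ω, inner ℝ x (X ω) * inner ℝ y (X ω) ∂P = inner ℝ x (A.toEuclideanLin y) := by
  have hint : ∀ s t, Integrable (fun ω => X ω s * x s * (X ω t * y t)) P := fun s t => by
    simp only [mul_mul_mul_comm _ (x s)]
    exact ((hX s).integrable_mul (hX t)).mul_const _
  simp only [PiLp.inner_apply, RCLike.inner_apply, conj_trivial, Finset.sum_mul_sum]
  rw [integral_finsetSum _ fun s _ => integrable_finsetSum _ fun t _ => hint s t]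
  refine Finset.sum_congr rfl fun s _ => ?_
  rw [integral_finsetSum _ fun t _ => hint s t, Matrix.toLpLin_apply]
  simp only [mul_mul_mul_comm _ (x s), integral_mul_const, hA, Matrix.mulVec, dotProduct,
    Finset.sum_mul]
  exact Finset.sum_congr rfl fun t _ => by ring

theorem posSemidef_of_integral_mul_eq {κ : Type*} [Finite κ] {X : Ω → EuclideanSpace ℝ κ}
    (hX : ∀ s, MemLp (fun ω => X ω s) 2 P) {A : Matrix κ κ ℝ}
    (hA : ∀ s t, ∫ ω, X ω s * X ω t ∂P = A s t) : A.PosSemidef := by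
  classical
  have := Fintype.ofFinite κ
  have hinner := integral_inner_mul_inner_eq_inner_toEuclideanLin hX hA
  refine Matrix.isPositive_toEuclideanLin_iff.1 ⟨fun x y => ?_, fun x => ?_⟩
  · rw [real_inner_comm, ← hinner, ← hinner]
    simp_rw [mul_comm]
  · rw [real_inner_comm, ← hinner]
    exact integral_nonneg fun ω => mul_self_nonneg _

theorem log_integral_exp_neg_mul_norm_add_sq_eigenvalues [DecidableEq ι]
    {X : Ω → EuclideanSpace ℝ ι} (hX : HasGaussianLaw X P)
    (hmean : ∀ s, ∫ ω, X ω s ∂P = 0) {A : Matrix ι ι ℝ}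
    (hcov : ∀ s t, ∫ ω, X ω s * X ω t ∂P = A s t) (hA : A.IsHermitian) {α : ℝ}
    (hα : ∀ i, 0 < 1 + 2 * α * hA.eigenvalues i) (c : EuclideanSpace ℝ ι) :
    Real.log (∫ ω, Real.exp (-α * ‖X ω + c‖ ^ 2) ∂P) =
      ∑ i, (-(1 / 2) * Real.log (1 + 2 * α * hA.eigenvalues i) -
        α * (inner ℝ (hA.eigenvectorBasis i) c ^ 2 * (1 + 2 * α * hA.eigenvalues i)⁻¹)) := by
  have hcoord : ∀ s, HasGaussianLaw (fun ω => X ω s) P := fun s =>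
    hX.map_fun (EuclideanSpace.proj s)
  have hL2 : ∀ s, MemLp (fun ω => X ω s) 2 P := fun s => (hcoord s).memLp_two
  have hinner : ∀ i j, ∫ ω, inner ℝ (hA.eigenvectorBasis i) (X ω) *
      inner ℝ (hA.eigenvectorBasis j) (X ω) ∂P =
        hA.eigenvalues j * inner ℝ (hA.eigenvectorBasis i) (hA.eigenvectorBasis j) := fun i j => by
    rw [integral_inner_mul_inner_eq_inner_toEuclideanLin hL2 hcov, Matrix.toLpLin_apply,
      hA.mulVec_eigenvectorBasis, WithLp.toLp_smul, real_inner_smul_right]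
  have hnonneg := (posSemidef_of_integral_mul_eq hL2 hcov).eigenvalues_nonneg
  refine log_integral_exp_neg_mul_norm_add_sq hA.eigenvectorBasis hX
    (v := fun i => ⟨hA.eigenvalues i, hnonneg i⟩) (fun i => ?_) (fun i => ?_)
    (fun i j hij => ?_) hα c
  · simp only [PiLp.inner_apply, RCLike.inner_apply, conj_trivial]
    rw [integral_finsetSum _ fun s _ => (hcoord s).integrable.mul_const _]
    simp only [integral_mul_const, hmean, zero_mul, Finset.sum_const_zero]
  · rw [hinner, real_inner_self_eq_norm_sq, OrthonormalBasis.norm_eq_one, one_pow, mul_one]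
    rfl
  · simp [hinner, hA.eigenvectorBasis.inner_eq_zero hij]

theorem hasGaussianLaw_toLp_comp {κ T : Type*} [Finite κ] {Z : T → Ω → ℝ}
    (hZ : IsGaussianProcess Z P) (τ : κ → T) :
    HasGaussianLaw (fun ω => WithLp.toLp 2 fun i => Z (τ i) ω) P := by
  classical
  have := Fintype.ofFinite κ
  refine HasGaussianLaw.toLp_pi 2 (X := fun i => Z (τ i)) ?_
  exact (hZ.hasGaussianLaw (Finset.univ.image τ)).map_fun
    (ContinuousLinearMap.pi fun i : κ => ContinuousLinearMap.proj
      (⟨τ i, Finset.mem_image_of_mem τ (Finset.mem_univ i)⟩ : Finset.univ.image τ))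

end Gaussian

section Functional

theorem exists_forall_dist_le_add_mul_dist_sq {X Y : Type*} [PseudoMetricSpace X]
    [PseudoMetricSpace Y] {S : Set X} (hS : IsCompact S) {g : X → Y} (hg : ContinuousOn g S)
    {ε : ℝ} (hε : 0 < ε) :
    ∃ C, ∀ x ∈ S, ∀ y ∈ S, dist (g x) (g y) ≤ ε + C * dist x y ^ 2 := by
  obtain ⟨δ, hδ, hclose⟩ :=
    Metric.uniformContinuousOn_iff.1 (hS.uniformContinuousOn_of_continuous hg) ε hε
  have hbdd : Bornology.IsBounded (g '' S) := (hS.image_of_continuousOn hg).isBounded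
  refine ⟨Metric.diam (g '' S) / δ ^ 2, fun x hx y hy => ?_⟩
  rcases lt_or_ge (dist x y) δ with hlt | hge
  · exact (hclose x hx y hy hlt).le.trans (le_add_of_nonneg_right (by positivity))
  · calc dist (g x) (g y) ≤ Metric.diam (g '' S) :=
          Metric.dist_le_diam_of_mem hbdd (Set.mem_image_of_mem g hx) (Set.mem_image_of_mem g hy)
      _ = Metric.diam (g '' S) / δ ^ 2 * δ ^ 2 := by field_simp
      _ ≤ Metric.diam (g '' S) / δ ^ 2 * dist x y ^ 2 := by gcongr
      _ ≤ ε + Metric.diam (g '' S) / δ ^ 2 * dist x y ^ 2 := le_add_of_nonneg_left hε.le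

variable {𝕜 E ι : Type*} [RCLike 𝕜] [NormedAddCommGroup E] [InnerProductSpace 𝕜 E] [Fintype ι]
  {b : OrthonormalBasis ι 𝕜 E} {T : E →ₗ[𝕜] E}

theorem inner_map_of_eigenbasis {l : ι → 𝕜} (hT : ∀ i, T (b i) = l i • b i) (i : ι) (x : E) :
    inner 𝕜 (b i) (T x) = l i * inner 𝕜 (b i) x := by
  classical
  conv_lhs => rw [← b.sum_repr' x]
  simp [hT, inner_sum, inner_smul_right, orthonormal_iff_ite.1 b.orthonormal, mul_comm]

theorem sum_norm_inner_sq_mul_norm_sub_sq {l : ι → 𝕜} (hT : ∀ i, T (b i) = l i • b i) (c : 𝕜)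
    (x : E) :
    ∑ i, ‖inner 𝕜 (b i) x‖ ^ 2 * ‖l i - c‖ ^ 2 = ‖T x - c • x‖ ^ 2 := by
  rw [← b.sum_sq_norm_inner_right]
  refine Finset.sum_congr rfl fun i _ => ?_
  rw [inner_sub_right, inner_smul_right, inner_map_of_eigenbasis hT, ← sub_mul, norm_mul]
  ring

theorem abs_sum_norm_inner_sq_mul_sub_le {l : ι → 𝕜} (hT : ∀ i, T (b i) = l i • b i) {c : 𝕜}
    {g : 𝕜 → ℝ} {ε C : ℝ} (hg : ∀ i, |g (l i) - g c| ≤ ε + C * ‖l i - c‖ ^ 2) (x : E) :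
    |∑ i, ‖inner 𝕜 (b i) x‖ ^ 2 * g (l i) - ‖x‖ ^ 2 * g c| ≤
      ε * ‖x‖ ^ 2 + C * ‖T x - c • x‖ ^ 2 := by
  rw [← sum_norm_inner_sq_mul_norm_sub_sq hT, ← b.sum_sq_norm_inner_right, Finset.sum_mul,
    ← Finset.sum_sub_distrib, Finset.mul_sum, Finset.mul_sum, ← Finset.sum_add_distrib]
  refine (Finset.abs_sum_le_sum_abs _ _).trans (Finset.sum_le_sum fun i _ => ?_)
  rw [← mul_sub, abs_mul, abs_of_nonneg (by positivity)]
  exact (mul_le_mul_of_nonneg_left (hg i) (by positivity)).trans_eq (by ring)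

end Functional

section Toeplitz

theorem norm_sub_sum_le_of_hasSum {β E : Type*} [NormedAddCommGroup E] {f : β → E} {a : E}
    (hf : HasSum f a) {w : β → ℝ} (hw : Summable w) (hfw : ∀ t, ‖f t‖ ≤ w t) (F : Finset β) :
    ‖a - ∑ t ∈ F, f t‖ ≤ ∑' t, w t - ∑ t ∈ F, w t := by
  have hf' : HasSum (fun t : {t // t ∉ F} => f t) (a - ∑ t ∈ F, f t) :=
    F.hasSum_compl_iff.2 (by rwa [sub_add_cancel])
  have hw' : HasSum (fun t : {t // t ∉ F} => w t) (∑' t, w t - ∑ t ∈ F, w t) :=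
    F.hasSum_compl_iff.2 (by simpa only [sub_add_cancel] using hw.hasSum)
  exact hf'.norm_le_of_bounded hw' fun t => hfw t

/-- The `n × n` Toeplitz matrix `(k (t - s))_{s, t < n}`, which is the covariance matrix of `n`
consecutive values of a stationary process with covariance function `k`. -/
def toeplitz {R : Type*} (k : ℤ → R) (n : ℕ) : Matrix (Fin n) (Fin n) R :=
  Matrix.of fun s t => k (t - s)

/-- The finite section `(x 0, …, x (n - 1))` of a two-sided sequence, as a Euclidean vector. -/
noncomputable def truncate (x : ℤ → ℝ) (n : ℕ) : EuclideanSpace ℝ (Fin n) :=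
  WithLp.toLp 2 fun t => x t

/-- The mass of `|k|` outside the window `[-j, j]`; it controls the error made in a row of a
Toeplitz matrix at distance `j` from the boundary. -/
noncomputable def absTail (k : ℤ → ℝ) (j : ℕ) : ℝ :=
  ∑' t, |k t| - ∑ t ∈ Finset.Icc (-j : ℤ) j, |k t|

variable {k x : ℤ → ℝ} {c : ℝ} {n : ℕ}

theorem isHermitian_toeplitz (hsymm : ∀ t, k (-t) = k t) (n : ℕ) : (toeplitz k n).IsHermitian :=
  Matrix.IsHermitian.ext fun s t => by simp [toeplitz, ← hsymm (t - s)]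

theorem norm_sq_truncate_le (hx : ∀ t, |x t| ≤ 1) (n : ℕ) : ‖truncate x n‖ ^ 2 ≤ n := by
  rw [EuclideanSpace.norm_sq_eq]
  calc ∑ t, ‖truncate x n t‖ ^ 2 ≤ ∑ _t : Fin n, (1 : ℝ) :=
        Finset.sum_le_sum fun t _ => pow_le_one₀ (norm_nonneg _) (hx t)
    _ = n := by simp

theorem tendsto_absTail (hk : Summable fun t => |k t|) : Tendsto (absTail k) atTop (𝓝 0) := by
  have hlim : Tendsto (fun j : ℕ => ∑ t ∈ Finset.Icc (-j : ℤ) j, |k t|) atTop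
      (𝓝 (∑' t, |k t|)) :=
    hk.hasSum.comp (Finset.tendsto_Icc_neg.comp tendsto_natCast_atTop_atTop)
  exact (sub_self (∑' t, |k t|)) ▸ hlim.const_sub (∑' t, |k t|)

theorem injective_natCast_sub (n : ℕ) (s : ℤ) :
    Function.Injective fun t : Fin n => (t : ℤ) - s := fun t t' h => Fin.ext (by simpa using h)

theorem abs_toeplitz_mulVec_sub_le (hk : Summable fun t => |k t|) (hx : ∀ t, |x t| ≤ 1)
    (hc : ∀ s, HasSum (fun t => k t * x (t + s)) (c * x s)) (s : Fin n) :
    |∑ t, toeplitz k n s t * x t - c * x s| ≤ absTail k (min s (n - 1 - s)) := by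
  have hsum : ∑ t, toeplitz k n s t * x t =
      ∑ u ∈ Finset.univ.image fun t : Fin n => (t : ℤ) - s, k u * x (u + s) := by
    simp [Finset.sum_image (injective_natCast_sub n s).injOn, toeplitz]
  have hwindow : Finset.Icc (-(min s (n - 1 - s) : ℕ) : ℤ) (min s (n - 1 - s) : ℕ) ⊆
      Finset.univ.image fun t : Fin n => (t : ℤ) - s := fun u hu => by
    rw [Finset.mem_Icc] at hu
    rw [Finset.mem_image]
    exact ⟨⟨(u + s).toNat, by lia⟩, Finset.mem_univ _, by dsimp only; lia⟩
  have hbound : ∀ u, ‖k u * x (u + s)‖ ≤ |k u| := fun u => by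
    rw [Real.norm_eq_abs, abs_mul]
    exact mul_le_of_le_one_right (abs_nonneg _) (hx _)
  rw [hsum, abs_sub_comm]
  exact (norm_sub_sum_le_of_hasSum (hc s) hk hbound _).trans (sub_le_sub_left
    (Finset.sum_le_sum_of_subset_of_nonneg hwindow fun _ _ _ => abs_nonneg _) _)

theorem norm_sq_toeplitz_sub_smul_le (hk : Summable fun t => |k t|) (hx : ∀ t, |x t| ≤ 1)
    (hc : ∀ s, HasSum (fun t => k t * x (t + s)) (c * x s)) (n : ℕ) :
    ‖(toeplitz k n).toEuclideanLin (truncate x n) - c • truncate x n‖ ^ 2 ≤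
      2 * ∑ j ∈ Finset.range n, absTail k j ^ 2 := by
  have hrow : ∀ s : Fin n, |∑ t, toeplitz k n s t * x t - c * x s| ^ 2 ≤
      absTail k s ^ 2 + absTail k (n - 1 - s) ^ 2 := fun s => by
    refine (pow_le_pow_left₀ (abs_nonneg _) (abs_toeplitz_mulVec_sub_le hk hx hc s) 2).trans ?_
    rcases min_choice (s : ℕ) (n - 1 - s) with h | h <;> rw [h]
    · exact le_add_of_nonneg_right (sq_nonneg _)
    · exact le_add_of_nonneg_left (sq_nonneg _)
  calc ‖(toeplitz k n).toEuclideanLin (truncate x n) - c • truncate x n‖ ^ 2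
      = ∑ s : Fin n, |∑ t, toeplitz k n s t * x t - c * x s| ^ 2 := by
        rw [EuclideanSpace.norm_sq_eq]
        rfl
    _ ≤ ∑ s : Fin n, (absTail k s ^ 2 + absTail k (n - 1 - s) ^ 2) :=
        Finset.sum_le_sum fun s _ => hrow s
    _ = 2 * ∑ j ∈ Finset.range n, absTail k j ^ 2 := by
        rw [Fin.sum_univ_eq_sum_range fun j => absTail k j ^ 2 + absTail k (n - 1 - j) ^ 2,
          Finset.sum_add_distrib, Finset.sum_range_reflect fun j => absTail k j ^ 2, two_mul]

theorem tendsto_inv_mul_norm_sq_toeplitz_sub_smul (hk : Summable fun t => |k t|)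
    (hx : ∀ t, |x t| ≤ 1) (hc : ∀ s, HasSum (fun t => k t * x (t + s)) (c * x s)) :
    Tendsto (fun n : ℕ => (n : ℝ)⁻¹ *
      ‖(toeplitz k n).toEuclideanLin (truncate x n) - c • truncate x n‖ ^ 2) atTop (𝓝 0) := by
  have hcesaro : Tendsto (fun n : ℕ => 2 * ((n : ℝ)⁻¹ * ∑ j ∈ Finset.range n, absTail k j ^ 2))
      atTop (𝓝 0) := by
    simpa using ((tendsto_absTail hk).pow 2).cesaro.const_mul 2
  refine squeeze_zero (fun n => by positivity) (fun n => ?_) hcesaro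
  rw [mul_left_comm]
  gcongr
  exact norm_sq_toeplitz_sub_smul_le hk hx hc n

theorem abs_eigenvalues_toeplitz_le (hk : Summable fun t => |k t|)
    (hA : (toeplitz k n).IsHermitian) (i : Fin n) : |hA.eigenvalues i| ≤ ∑' t, |k t| := by
  have heig : Module.End.HasEigenvalue (Matrix.toLin' (toeplitz k n)) (hA.eigenvalues i) := by
    rw [Module.End.hasEigenvalue_iff_mem_spectrum, Matrix.spectrum_toLin']
    exact hA.eigenvalues_mem_spectrum_real i
  obtain ⟨s, hs⟩ := eigenvalue_mem_ball heig
  calc |hA.eigenvalues i| ≤ |toeplitz k n s s| + ∑ t ∈ Finset.univ.erase s, |toeplitz k n s t| :=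
        norm_le_norm_add_const_of_dist_le (Metric.mem_closedBall.1 hs)
    _ = ∑ t, |toeplitz k n s t| :=
        Finset.add_sum_erase _ (fun t => |toeplitz k n s t|) (Finset.mem_univ s)
    _ = ∑' t : Fin n, |k (t - s)| := (tsum_fintype _).symm
    _ ≤ ∑' t, |k t| :=
        tsum_comp_le_tsum_of_inj hk (fun _ => abs_nonneg _) (injective_natCast_sub n s)

end Toeplitz

section Waves

/-- The real wave of frequency `u` and phase `φ`. Convolution with a symmetric summable `k`
multiplies every wave of frequency `u` by the spectral density at `u`. -/
noncomputable def wave (u φ : ℝ) (t : ℤ) : ℝ :=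
  Real.cos (u * t - φ)

/-- The periodogram `|∑ t, v t * exp (i u t)| ^ 2` of a vector, written with the two real waves
`cos (u t)` and `sin (u t)`. -/
noncomputable def periodogram {n : ℕ} (v : EuclideanSpace ℝ (Fin n)) (u : ℝ) : ℝ :=
  inner ℝ v (truncate (wave u 0) n) ^ 2 + inner ℝ v (truncate (wave u (Real.pi / 2)) n) ^ 2

variable {k : ℤ → ℝ} {n : ℕ}

theorem abs_wave_le_one (u φ : ℝ) (t : ℤ) : |wave u φ t| ≤ 1 :=
  Real.abs_cos_le_one _

theorem hasSum_mul_wave (hk : Summable fun t => |k t|) (hsymm : ∀ t, k (-t) = k t) (u φ : ℝ)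
    (s : ℤ) :
    HasSum (fun t => k t * wave u φ (t + s)) ((spectralDensity k u).re * wave u φ s) := by
  have hexp : ∀ t : ℤ, Complex.exp (Complex.I * u * t) = Complex.exp ((u * t : ℝ) * Complex.I) :=
    fun t => by
      push_cast
      ring_nf
  have hsummable : Summable fun t : ℤ => Complex.exp (Complex.I * u * t) * (k t : ℂ) :=
    Summable.of_norm_bounded hk fun t => by
      simp [hexp, Complex.norm_exp_ofReal_mul_I, -Complex.ofReal_mul]
  have hsum := Complex.hasSum_re
    (hsummable.hasSum.mul_right (Complex.exp ((u * s - φ : ℝ) * Complex.I)))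
  rw [← spectralDensity, spectralDensity_eq_re hsymm, Complex.re_ofReal_mul,
    Complex.exp_ofReal_mul_I_re] at hsum
  refine hsum.congr_fun fun t => ?_
  rw [hexp, mul_right_comm, ← Complex.exp_add, ← add_mul, ← Complex.ofReal_add,
    Complex.re_mul_ofReal, Complex.exp_ofReal_mul_I_re, mul_comm, wave]
  push_cast
  ring_nf

theorem wave_sq_add_wave_sq (u : ℝ) (t : ℤ) : wave u 0 t ^ 2 + wave u (Real.pi / 2) t ^ 2 = 1 := by
  simp [wave, Real.cos_sub_pi_div_two]

theorem norm_sq_truncate_wave_add (u : ℝ) (n : ℕ) :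
    ‖truncate (wave u 0) n‖ ^ 2 + ‖truncate (wave u (Real.pi / 2)) n‖ ^ 2 = n := by
  simp [EuclideanSpace.norm_sq_eq, truncate, ← Finset.sum_add_distrib, wave_sq_add_wave_sq]

theorem periodogram_nonneg (v : EuclideanSpace ℝ (Fin n)) (u : ℝ) : 0 ≤ periodogram v u := by
  unfold periodogram
  positivity

theorem periodogram_zero (v : EuclideanSpace ℝ (Fin n)) :
    periodogram v 0 = inner ℝ v (truncate 1 n) ^ 2 := by
  simp [periodogram, PiLp.inner_apply, truncate, wave]

theorem periodogram_eq_sum_cos (v : EuclideanSpace ℝ (Fin n)) (u : ℝ) :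
    periodogram v u = ∑ s : Fin n, ∑ t : Fin n, v s * v t * Real.cos (u * (s - t : ℤ)) := by
  simp only [periodogram, PiLp.inner_apply, truncate, wave, RCLike.inner_apply, conj_trivial, sq,
    Finset.sum_mul_sum, ← Finset.sum_add_distrib]
  refine Finset.sum_congr rfl fun s _ => Finset.sum_congr rfl fun t _ => ?_
  rw [sub_zero, sub_zero, Real.cos_sub_pi_div_two, Real.cos_sub_pi_div_two, Int.cast_sub, mul_sub,
    Real.cos_sub]
  ring

theorem continuous_periodogram (v : EuclideanSpace ℝ (Fin n)) : Continuous (periodogram v) := by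
  simp only [funext (periodogram_eq_sum_cos v)]
  fun_prop

theorem integral_cos_mul_intCast (j : ℤ) :
    ∫ u in (0 : ℝ)..(2 * Real.pi), Real.cos (u * j) = if j = 0 then 2 * Real.pi else 0 := by
  split_ifs with h
  · simp [h]
  · rw [intervalIntegral.integral_comp_mul_right _ (Int.cast_ne_zero.2 h), integral_cos,
      mul_comm (2 * Real.pi), Real.sin_periodic.int_mul_eq, zero_mul, sub_self, smul_zero]

theorem integral_periodogram (v : EuclideanSpace ℝ (Fin n)) :
    ∫ u in (0 : ℝ)..(2 * Real.pi), periodogram v u = 2 * Real.pi * ‖v‖ ^ 2 := by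
  have hterm : ∀ s t : Fin n,
      ∫ u in (0 : ℝ)..(2 * Real.pi), v s * v t * Real.cos (u * (s - t : ℤ)) =
        if s = t then 2 * Real.pi * v s ^ 2 else 0 := fun s t => by
    rw [intervalIntegral.integral_const_mul, integral_cos_mul_intCast]
    rcases eq_or_ne s t with rfl | h
    · simp [sq, mul_comm]
    · simp [h, sub_eq_zero, Fin.val_inj]
  simp_rw [periodogram_eq_sum_cos]
  rw [intervalIntegral.integral_finsetSum
    fun s _ => Continuous.intervalIntegrable (by fun_prop) _ _, EuclideanSpace.norm_sq_eq,
    Finset.mul_sum]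
  refine Finset.sum_congr rfl fun s _ => ?_
  rw [intervalIntegral.integral_finsetSum
    fun t _ => Continuous.intervalIntegrable (by fun_prop) _ _]
  simp only [hterm, Finset.sum_ite_eq, Finset.mem_univ, if_true, Real.norm_eq_abs, sq_abs]

variable {ι : Type*} [Fintype ι] (b : OrthonormalBasis ι ℝ (EuclideanSpace ℝ (Fin n)))

theorem sum_periodogram (u : ℝ) : ∑ i, periodogram (b i) u = n := by
  rw [← norm_sq_truncate_wave_add u, ← b.sum_sq_inner_right, ← b.sum_sq_inner_right,
    ← Finset.sum_add_distrib]
  rfl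

theorem norm_sum_periodogram_mul_le {w : ι → ℝ} {B : ℝ} (hw : ∀ i, ‖w i‖ ≤ B) (u : ℝ) :
    ‖∑ i, periodogram (b i) u * w i‖ ≤ n * B := by
  rw [← sum_periodogram b u, Finset.sum_mul]
  refine norm_sum_le_of_le _ fun i _ => ?_
  rw [norm_mul, Real.norm_of_nonneg (periodogram_nonneg _ _)]
  exact mul_le_mul_of_nonneg_left (hw i) (periodogram_nonneg _ _)

theorem integral_sum_periodogram_mul (w : ι → ℝ) :
    ∫ u in (0 : ℝ)..(2 * Real.pi), ∑ i, periodogram (b i) u * w i =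
      2 * Real.pi * ∑ i, w i := by
  rw [intervalIntegral.integral_finsetSum fun i _ =>
    ((continuous_periodogram (b i)).intervalIntegrable _ _).mul_const (w i)]
  simp only [intervalIntegral.integral_mul_const, integral_periodogram,
    OrthonormalBasis.norm_eq_one, one_pow, mul_one, Finset.mul_sum]

end Waves

section Szego

variable {k : ℤ → ℝ} {S : Set ℝ} {g : ℝ → ℝ}

theorem tendsto_sum_inner_truncate_sq_mul_sub (hk : Summable fun t => |k t|)
    (hA : ∀ n, (toeplitz k n).IsHermitian) (hS : IsCompact S)
    (hAS : ∀ n i, (hA n).eigenvalues i ∈ S) (hg : ContinuousOn g S) {x : ℤ → ℝ} {c : ℝ}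
    (hx : ∀ t, |x t| ≤ 1) (hc : ∀ s, HasSum (fun t => k t * x (t + s)) (c * x s)) (hcS : c ∈ S) :
    Tendsto (fun n : ℕ => (n : ℝ)⁻¹ *
      (∑ i, inner ℝ ((hA n).eigenvectorBasis i) (truncate x n) ^ 2 * g ((hA n).eigenvalues i) -
        ‖truncate x n‖ ^ 2 * g c)) atTop (𝓝 0) := by
  refine Metric.tendsto_nhds.2 fun ε hε => ?_
  obtain ⟨C, hC⟩ := exists_forall_dist_le_add_mul_dist_sq hS hg (half_pos hε)
  have herr := (tendsto_inv_mul_norm_sq_toeplitz_sub_smul hk hx hc).const_mul C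
  rw [mul_zero] at herr
  filter_upwards [herr.eventually_lt_const (half_pos hε)] with n hn
  have heigen : ∀ i, (toeplitz k n).toEuclideanLin ((hA n).eigenvectorBasis i) =
      (hA n).eigenvalues i • (hA n).eigenvectorBasis i := fun i => by
    rw [Matrix.toLpLin_apply, (hA n).mulVec_eigenvectorBasis, WithLp.toLp_smul]
  have hquad := abs_sum_norm_inner_sq_mul_sub_le heigen
    (fun i => hC _ (hAS n i) c hcS) (truncate x n)
  simp only [Real.norm_eq_abs, sq_abs] at hquad
  have hnorm : (n : ℝ)⁻¹ * ‖truncate x n‖ ^ 2 ≤ 1 :=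
    (mul_le_mul_of_nonneg_left (norm_sq_truncate_le hx n) (by positivity)).trans inv_mul_le_one
  rw [Real.dist_0_eq_abs, abs_mul, abs_of_nonneg (by positivity : (0 : ℝ) ≤ (n : ℝ)⁻¹)]
  calc _ ≤ (n : ℝ)⁻¹ * (ε / 2 * ‖truncate x n‖ ^ 2 +
          C * ‖(toeplitz k n).toEuclideanLin (truncate x n) - c • truncate x n‖ ^ 2) := by gcongr
    _ = ε / 2 * ((n : ℝ)⁻¹ * ‖truncate x n‖ ^ 2) + C * ((n : ℝ)⁻¹ *
          ‖(toeplitz k n).toEuclideanLin (truncate x n) - c • truncate x n‖ ^ 2) := by ring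
    _ < ε := by linarith [mul_le_of_le_one_right (half_pos hε).le hnorm]

variable (hk : Summable fun t => |k t|) (hsymm : ∀ t, k (-t) = k t) (hS : IsCompact S)
  (hkS : ∀ n i, (isHermitian_toeplitz hsymm n).eigenvalues i ∈ S)
include hk hS hkS

theorem tendsto_sum_periodogram_mul_of_mem (hg : ContinuousOn g S) {u : ℝ}
    (hu : (spectralDensity k u).re ∈ S) :
    Tendsto (fun n : ℕ => (n : ℝ)⁻¹ *
      ∑ i, periodogram ((isHermitian_toeplitz hsymm n).eigenvectorBasis i) u *
        g ((isHermitian_toeplitz hsymm n).eigenvalues i))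
      atTop (𝓝 (g (spectralDensity k u).re)) := by
  have hwave := fun φ => tendsto_sum_inner_truncate_sq_mul_sub hk
    (isHermitian_toeplitz hsymm) hS hkS hg (abs_wave_le_one u φ) (hasSum_mul_wave hk hsymm u φ) hu
  have hadd := ((hwave 0).add (hwave (Real.pi / 2))).add_const (g (spectralDensity k u).re)
  rw [add_zero, zero_add] at hadd
  refine hadd.congr' ?_
  filter_upwards [eventually_ne_atTop 0] with n hn
  have hn' : (n : ℝ) ≠ 0 := Nat.cast_ne_zero.2 hn
  simp only [periodogram, add_mul, Finset.sum_add_distrib]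
  field_simp
  linear_combination -g (spectralDensity k u).re * norm_sq_truncate_wave_add u n

theorem spectralDensity_re_mem (u : ℝ) : (spectralDensity k u).re ∈ S := by
  have hne : S.Nonempty := ⟨_, hkS 1 0⟩
  have hlim := tendsto_sum_periodogram_mul_of_mem hk hsymm (hS.insert _)
    (fun n i => Set.mem_insert_of_mem _ (hkS n i)) (Metric.continuous_infDist_pt S).continuousOn
    (Set.mem_insert (spectralDensity k u).re S)
  simp only [Metric.infDist_zero_of_mem (hkS _ _), mul_zero, Finset.sum_const_zero] at hlim
  exact (hS.isClosed.mem_iff_infDist_zero hne).2 (tendsto_nhds_unique hlim tendsto_const_nhds)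

theorem tendsto_sum_periodogram_mul (hg : ContinuousOn g S) (u : ℝ) :
    Tendsto (fun n : ℕ => (n : ℝ)⁻¹ *
      ∑ i, periodogram ((isHermitian_toeplitz hsymm n).eigenvectorBasis i) u *
        g ((isHermitian_toeplitz hsymm n).eigenvalues i))
      atTop (𝓝 (g (spectralDensity k u).re)) :=
  tendsto_sum_periodogram_mul_of_mem hk hsymm hS hkS hg
    (spectralDensity_re_mem hk hsymm hS hkS u)

theorem tendsto_inv_mul_sum_eigenvalues_toeplitz (hg : ContinuousOn g S) :
    Tendsto (fun n : ℕ => (n : ℝ)⁻¹ * ∑ i, g ((isHermitian_toeplitz hsymm n).eigenvalues i))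
      atTop (𝓝 (1 / (2 * Real.pi) *
        ∫ u in (0 : ℝ)..(2 * Real.pi), g (spectralDensity k u).re)) := by
  obtain ⟨B, hB⟩ := hS.exists_bound_of_continuousOn hg
  set F : ℕ → ℝ → ℝ := fun n u => (n : ℝ)⁻¹ *
    ∑ i, periodogram ((isHermitian_toeplitz hsymm n).eigenvectorBasis i) u *
      g ((isHermitian_toeplitz hsymm n).eigenvalues i) with hF
  have hcont : ∀ n, Continuous (F n) := fun n => continuous_const.mul <|
    continuous_finsetSum _ fun i _ => (continuous_periodogram _).mul continuous_const
  have hbound : ∀ n u, ‖F n u‖ ≤ B := fun n u =>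
    calc ‖F n u‖ ≤ (n : ℝ)⁻¹ * (n * B) := by
          rw [hF, norm_mul, Real.norm_of_nonneg (by positivity)]
          gcongr
          exact norm_sum_periodogram_mul_le _ (fun i => hB _ (hkS n i)) u
      _ ≤ B := by
          rw [← mul_assoc]
          exact mul_le_of_le_one_left ((norm_nonneg _).trans (hB _ (hkS 1 0))) inv_mul_le_one
  have hint : ∀ n : ℕ, (n : ℝ)⁻¹ * ∑ i, g ((isHermitian_toeplitz hsymm n).eigenvalues i) =
      1 / (2 * Real.pi) * ∫ u in (0 : ℝ)..(2 * Real.pi), F n u := fun n => by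
    rw [hF, intervalIntegral.integral_const_mul, integral_sum_periodogram_mul]
    field_simp
  simp_rw [hint]
  refine (intervalIntegral.tendsto_integral_filter_of_dominated_convergence (fun _ => B)
    (.of_forall fun n => (hcont n).aestronglyMeasurable)
    (.of_forall fun n => ae_of_all _ fun u _ => hbound n u) intervalIntegrable_const
    (ae_of_all _ fun u _ => ?_)).const_mul _
  exact tendsto_sum_periodogram_mul hk hsymm hS hkS hg u

end Szego

section GaussianProcess

variable {Ω : Type*} [MeasurableSpace Ω] {P : Measure Ω} {k : ℤ → ℝ} {Z : ℤ → Ω → ℝ}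

theorem apply_neg_of_integral_mul_eq (hcov : ∀ s t, ∫ ω, Z s ω * Z t ω ∂P = k (t - s)) (t : ℤ) :
    k (-t) = k t := by
  have hswap : ∫ ω, Z t ω * Z 0 ω ∂P = ∫ ω, Z 0 ω * Z t ω ∂P := by simp_rw [mul_comm]
  simpa [hcov] using hswap

theorem eigenvalues_toeplitz_mem_Icc (hk : Summable fun t => |k t|) (hZ : IsGaussianProcess Z P)
    (hcov : ∀ s t, ∫ ω, Z s ω * Z t ω ∂P = k (t - s)) {n : ℕ}
    (hA : (toeplitz k n).IsHermitian) (i : Fin n) :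
    hA.eigenvalues i ∈ Set.Icc 0 (∑' t, |k t|) := by
  have hpos : (toeplitz k n).PosSemidef :=
    posSemidef_of_integral_mul_eq (X := fun ω => truncate (Z · ω) n)
      (fun s => (hZ.hasGaussianLaw_eval s).memLp_two) fun s t => hcov s t
  exact ⟨hpos.eigenvalues_nonneg i, (le_abs_self _).trans (abs_eigenvalues_toeplitz_le hk hA i)⟩

theorem log_integral_exp_neg_mul_sum_range (hZ : IsGaussianProcess Z P)
    (hmean : ∀ t, ∫ ω, Z t ω ∂P = 0) (hcov : ∀ s t, ∫ ω, Z s ω * Z t ω ∂P = k (t - s)) {n : ℕ}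
    (hA : (toeplitz k n).IsHermitian) {α : ℝ} (hα : ∀ i, 0 < 1 + 2 * α * hA.eigenvalues i)
    (m : ℝ) :
    Real.log (∫ ω, Real.exp (-α * ∑ s ∈ Finset.range n, (Z s ω + m) ^ 2) ∂P) =
      -(1 / 2) * ∑ i, Real.log (1 + 2 * α * hA.eigenvalues i) -
        m ^ 2 * α * ∑ i, periodogram (hA.eigenvectorBasis i) 0 *
          (1 + 2 * α * hA.eigenvalues i)⁻¹ := by
  have hlaw : HasGaussianLaw (fun ω => truncate (Z · ω) n) P :=
    hasGaussianLaw_toLp_comp hZ fun i : Fin n => (i : ℤ)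
  have hnorm : ∀ ω, ∑ s ∈ Finset.range n, (Z s ω + m) ^ 2 =
      ‖truncate (Z · ω) n + m • truncate 1 n‖ ^ 2 := fun ω => by
    simp [EuclideanSpace.norm_sq_eq, truncate, Finset.sum_range]
  simp_rw [hnorm]
  rw [log_integral_exp_neg_mul_norm_add_sq_eigenvalues (A := toeplitz k n) hlaw
    (fun s => hmean s) (fun s t => hcov s t) hA hα, Finset.sum_sub_distrib,
    Finset.mul_sum, Finset.mul_sum]
  congr 1
  refine Finset.sum_congr rfl fun i _ => ?_
  rw [periodogram_zero, real_inner_smul_right]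
  ring

end GaussianProcess

theorem proposition2_general {Ω : Type*} [MeasurableSpace Ω] (P : Measure Ω)
    (k : ℤ → ℝ) (M : ℝ) (hM : HasSum (fun t : ℤ => |k t|) M)
    (Z : ℤ → Ω → ℝ) (hZ : IsGaussianProcess Z P)
    (hmean : ∀ t : ℤ, ∫ ω, Z t ω ∂P = 0)
    (hcov : ∀ s t : ℤ, ∫ ω, Z s ω * Z t ω ∂P = k (t - s))
    (mInf : ℝ) (α : ℝ) (hαM : -1 < 2 * α * M) :
    Tendsto
      (fun t : ℕ => 1 / (t : ℝ) *
        Real.log (∫ ω, Real.exp (-α * ∑ s ∈ Finset.range t, (Z (s : ℤ) ω + mInf) ^ 2) ∂P))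
      atTop (𝓝 (-ell0 k α - ell1 k mInf α)) := by
  have hsymm := apply_neg_of_integral_mul_eq hcov
  have hspec : ∀ n i, (isHermitian_toeplitz hsymm n).eigenvalues i ∈ Set.Icc 0 M := fun n i =>
    hM.tsum_eq ▸ eigenvalues_toeplitz_mem_Icc hM.summable hZ hcov _ i
  have hpos : ∀ x ∈ Set.Icc 0 M, 0 < 1 + 2 * α * x := fun x hx => by
    rcases le_total 0 α with h | h <;> nlinarith [hx.1, hx.2]
  have haffine : ContinuousOn (fun x => 1 + 2 * α * x) (Set.Icc 0 M) := by fun_prop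
  have hlog := tendsto_inv_mul_sum_eigenvalues_toeplitz hM.summable hsymm isCompact_Icc hspec
    (haffine.log fun x hx => (hpos x hx).ne')
  have hinv := tendsto_sum_periodogram_mul (g := fun x => (1 + 2 * α * x)⁻¹) hM.summable hsymm
    isCompact_Icc hspec (haffine.inv₀ fun x hx => (hpos x hx).ne') 0
  convert (hlog.const_mul (-(1 / 2))).sub (hinv.const_mul (mInf ^ 2 * α)) using 2 with n
  · rw [log_integral_exp_neg_mul_sum_range hZ hmean hcov _ fun i => hpos _ (hspec n i)]
    ring
  · rw [ell0, ell1]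
    ring

theorem proposition2 {Ω : Type*} [MeasurableSpace Ω] (P : Measure Ω) [IsProbabilityMeasure P]
    (k : ℤ → ℝ) (hk : IsPositiveDefiniteSymmetric k)
    (M : ℝ) (hM : HasSum (fun t : ℤ => |k t|) M)
    (Z : ℤ → Ω → ℝ) (hZ : IsGaussianProcess Z P)
    (hmean : ∀ t : ℤ, ∫ ω, Z t ω ∂P = 0)
    (hcov : ∀ s t : ℤ, ∫ ω, Z s ω * Z t ω ∂P = k (t - s))
    (mInf : ℝ) (α : ℝ) (hα : 0 ≤ α) (hαM : 2 * α * M < 1) :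
    Tendsto
      (fun t : ℕ => 1 / (t : ℝ) *
        Real.log (∫ ω, Real.exp (-α * ∑ s ∈ Finset.range t, (Z (s : ℤ) ω + mInf) ^ 2) ∂P))
      atTop (𝓝 (-ell0 k α - ell1 k mInf α)) := by
  have hM0 : 0 ≤ M := hM.nonneg fun t => abs_nonneg _
  exact proposition2_general P k M hM Z hZ hmean hcov mInf α
    (neg_one_lt_zero.trans_le (by positivity))
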